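/- Let $r\ge 2$ be an integer, let $\alpha\in\left(\frac{r-2}{r-1},\frac{r-1}{r}\right]$, and let $H$ be a finite simple graph with chromatic number $r$. Then there is an integer $n_0=n_0(r,\alpha,H)$ such that for every $n\ge n_0$ and every simple graph $G_\alpha$ on $n$ vertices with minimum degree $\delta(G_\alpha)\ge\alpha n$ the following holds. Two players, Maker and Breaker, alternately claim one previously unclaimed edge of $G_\alpha$ each, until all edges of $G_\alpha$ are claimed. Then Maker has a strategy, whichever player moves first, which guarantees against every play of Breaker that the edges claimed by Maker contain the edge set of a (not necessarily induced) copy of $H$ in $G_\alpha$. -/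

import Mathlib

namespace PositionalGame

/-- The two players of a Maker-Breaker game. -/
inductive Player : Type
  | maker
  | breaker

/-- The opponent of a player. -/
def Player.other : Player → Player
  | .maker => .breaker
  | .breaker => .maker

/-- The player who makes the move number `i` (counted from `0`) when the players alternate, one
element per move, and `first` moves first. -/
def mover (first : Player) (i : ℕ) : Player :=
  if Even i then first else first.other

/-- A (possibly unfinished) play on a finite board, written as the list of the claimed elements in
the order in which they were claimed: only elements of the board are claimed, none of them twice. -/
def IsPlay {X : Type*} (board : Finset X) (h : List X) : Prop :=
  h.Nodup ∧ ∀ x ∈ h, x ∈ board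

/-- A finished play: every element of the board has been claimed. -/
def IsFinished {X : Type*} (board : Finset X) (h : List X) : Prop :=
  IsPlay board h ∧ ∀ x ∈ board, x ∈ h

/-- The set of elements that player `p` has claimed in the play `h`. -/
def claimedBy {X : Type*} (first : Player) (h : List X) (p : Player) : Set X :=
  {x | ∃ i : ℕ, mover first i = p ∧ h[i]? = some x}

/-- `σ` is a strategy for player `p`: for every unfinished play in which it is the turn of `p`,
it names an element of the board that is still unclaimed. -/
def IsStrategy {X : Type*} (board : Finset X) (first p : Player) (σ : List X → X) : Prop :=
  ∀ h : List X, IsPlay board h → ¬ IsFinished board h → mover first h.length = p →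
    σ h ∈ board ∧ σ h ∉ h

/-- Every move of player `p` in the play `h` is the one that `σ` names. -/
def Follows {X : Type*} (first p : Player) (σ : List X → X) (h : List X) : Prop :=
  ∀ i : ℕ, i < h.length → mover first i = p → h[i]? = some (σ (h.take i))

/-- Maker has a winning strategy in the `(1:1)` Maker-Breaker game on the hypergraph with the
vertex set `board` and the family of winning sets `winning`, when `first` moves first: whatever
Breaker does, at the end Maker has claimed all elements of some winning set. -/
def MakerWins {X : Type*} (first : Player) (board : Finset X) (winning : Set (Set X)) : Prop :=
  ∃ σ : List X → X, IsStrategy board first .maker σ ∧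
    ∀ h : List X, IsFinished board h → Follows first .maker σ h →
      ∃ F ∈ winning, F ⊆ claimedBy first h .maker

/-- The winning sets of the `H`-game on `G`: the edge sets of all (not necessarily induced) copies
of `H` in `G`. -/
def copyEdgeSets {V W : Type*} (H : SimpleGraph W) (G : SimpleGraph V) : Set (Set (Sym2 V)) :=
  {F | ∃ f : SimpleGraph.Copy H G, F = Sym2.map f '' H.edgeSet}

end PositionalGame

/-!
The proof reduces the `H`-game on `G` to a game on a board of bounded size, where Beck's potential
argument applies.

By the minimum-degree form of the Erdős–Stone theorem, a large `G` whose minimum degree exceeds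
`(1 - 1 / (r - 1)) n` by a positive proportion of `n` contains the complete `r`-partite graph
`K_r(t)` for any prescribed `t`. Since `H` is `r`-colourable, `K_r(t)` contains a blow-up of `H` in
which each vertex of `H` is replaced by `s` vertices (`exists_blowUp_of_isContained`). Every choice
of one vertex from each of the `m` classes of the blow-up spans a copy of `H`; these `s ^ m` copies
are the only winning sets that Maker aims at.

Maker always claims an edge whose claim increases the most the potential `∑ 2⁻ᵏ`, where the sum is
over the copies that Breaker has not touched and `k` is the number of edges that Maker still lacks
(`beckStrategy`). A round in which Maker claims `x` and Breaker claims `y` then decreases the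
potential by at most the number `D` of the copies through both `x` and `y`, and only if `x` lies in
some copy. So the potential stays positive if at the start it exceeds `D` times the number of the
edges of the blow-up, with some room for the opening move of Breaker
(`makerWins_of_sum_gt`); at the end of the game a copy that contributes to the potential belongs to
Maker. Here the potential starts at `s ^ m / 2 ^ e(H)` or more, while two edges span at least three
vertices, so that `D ≤ s ^ (m - 3)`, and the blow-up has at most `(m s) ^ 2` edges; the inequality
holds as soon as `s` is large (`makerWins_copyEdgeSets_of_blowUp`). Edges of `G` outside the blow-up
lie in no copy and do not affect the potential, so the size of `G` plays no role.
-/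

namespace PositionalGame

open Finset

/-! ### Plays that grow by one move -/

section Play

variable {X : Type*} {first p : Player} {σ : List X → X} {h : List X} {x : X}
  {board : Finset X}

theorem claimedBy_nil : claimedBy first ([] : List X) p = ∅ := by
  ext; simp [claimedBy]

theorem claimedBy_concat_self (hp : mover first h.length = p) :
    claimedBy first (h ++ [x]) p = insert x (claimedBy first h p) := by
  ext y
  simp only [claimedBy, Set.mem_ofPred_eq, Set.mem_insert_iff, List.getElem?_append,
    List.getElem?_singleton]
  constructor
  · rintro ⟨i, hi, hy⟩
    split_ifs at hy with h1 h2
    · exact .inr ⟨i, hi, hy⟩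
    · exact .inl (Option.some.inj hy).symm
  · rintro (rfl | ⟨i, hi, hy⟩)
    · exact ⟨h.length, hp, by simp⟩
    · have h1 : i < h.length := (List.getElem?_eq_some_iff.1 hy).1
      exact ⟨i, hi, by simpa [h1] using hy⟩

theorem claimedBy_concat_of_ne (hp : mover first h.length ≠ p) :
    claimedBy first (h ++ [x]) p = claimedBy first h p := by
  ext y
  simp only [claimedBy, Set.mem_ofPred_eq, List.getElem?_append, List.getElem?_singleton]
  constructor
  · rintro ⟨i, hi, hy⟩
    split_ifs at hy with h1 h2
    · exact ⟨i, hi, hy⟩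
    · exact absurd ((show i = h.length by omega) ▸ hi) hp
  · rintro ⟨i, hi, hy⟩
    have h1 : i < h.length := (List.getElem?_eq_some_iff.1 hy).1
    exact ⟨i, hi, by simpa [h1] using hy⟩

theorem mem_of_mem_claimedBy (hx : x ∈ claimedBy first h p) : x ∈ h := by
  obtain ⟨i, -, hi⟩ := hx
  exact List.mem_of_getElem? hi

theorem mem_claimedBy_maker_or_breaker (hx : x ∈ h) :
    x ∈ claimedBy first h .maker ∨ x ∈ claimedBy first h .breaker := by
  obtain ⟨i, hi⟩ := List.getElem?_of_mem hx
  rcases hm : mover first i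
  · exact .inl ⟨i, hm, hi⟩
  · exact .inr ⟨i, hm, hi⟩

theorem mover_succ (i : ℕ) : mover first (i + 1) = (mover first i).other := by
  by_cases hi : Even i
  · simp [mover, hi, Nat.even_add_one]
  · cases first <;> simp [mover, hi, Nat.even_add_one, Player.other]

theorem IsPlay.of_concat (hh : IsPlay board (h ++ [x])) :
    IsPlay board h ∧ x ∈ board ∧ x ∉ h := by
  obtain ⟨h1, h2⟩ := hh
  rw [← List.concat_eq_append, List.nodup_concat] at h1
  exact ⟨⟨h1.2, fun y hy => h2 y (by simp [hy])⟩, h2 x (by simp), h1.1⟩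

theorem Follows.of_concat (hh : Follows first p σ (h ++ [x])) :
    Follows first p σ h ∧ (mover first h.length = p → x = σ h) := by
  constructor
  · intro i hi hp
    have := hh i (by simp; omega) hp
    rwa [List.getElem?_append_left hi, List.take_append_of_le_length hi.le] at this
  · intro hp
    simpa using hh h.length (by simp) hp

end Play

/-! ### The potential of a position -/

section Potential

open Classical in
/-- The potential of the position in which Maker holds `M` and Breaker holds `B`: every winning set
`F i` that Breaker has not touched contributes `2⁻ᵏ`, where `k` is the number of its elements that
Maker still lacks. -/
noncomputable def potential {X ι : Type*} [Fintype ι] (F : ι → Finset X) (M B : Set X) : ℝ :=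
  ∑ i, if Disjoint (F i : Set X) B then (1 / 2 : ℝ) ^ ((F i : Set X) \ M).ncard else 0

open Classical in
/-- The part of the potential that comes from the winning sets through `x`. Maker's claim of
`x` doubles the contribution of each of these sets and Breaker's claim destroys it, so the danger of
`x` is at once the increase of the potential in the first case and the decrease in the second. -/
noncomputable def danger {X ι : Type*} [Fintype ι] (F : ι → Finset X) (M B : Set X) (x : X) : ℝ :=
  ∑ i, if Disjoint (F i : Set X) B ∧ x ∈ F i then (1 / 2 : ℝ) ^ ((F i : Set X) \ M).ncard else 0

variable {X ι : Type*} [Fintype ι] {F : ι → Finset X} {M B : Set X} {x y : X}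

theorem danger_nonneg : 0 ≤ danger F M B x :=
  sum_nonneg fun i _ => by split_ifs <;> positivity

theorem danger_le_card [DecidableEq X] : danger F M B x ≤ #{i | x ∈ F i} := by
  rw [danger, ← sum_boole]
  refine sum_le_sum fun i _ => ?_
  by_cases hx : x ∈ F i
  · simp only [hx, and_true, if_true]
    split_ifs
    · exact pow_le_one₀ (by norm_num) (by norm_num)
    · norm_num
  · simp [hx]

theorem ncard_sdiff_insert_add_one {s : Finset X} (hM : x ∉ M) (hs : x ∈ s) :
    ((s : Set X) \ insert x M).ncard + 1 = ((s : Set X) \ M).ncard := by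
  rw [Set.insert_eq, Set.union_comm, ← Set.sdiff_sdiff]
  exact Set.ncard_sdiff_singleton_add_one ⟨hs, hM⟩ (s.finite_toSet.subset Set.sdiff_subset)

theorem sdiff_insert_of_notMem {s : Finset X} (hs : x ∉ s) :
    (s : Set X) \ insert x M = (s : Set X) \ M :=
  Set.sdiff_insert_of_notMem (by simpa using hs)

theorem potential_insert_maker (hx : x ∉ M) :
    potential F (insert x M) B = potential F M B + danger F M B x := by
  classical
  rw [potential, potential, danger, ← sum_add_distrib]
  refine sum_congr rfl fun i _ => ?_
  by_cases hB : Disjoint (F i : Set X) B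
  · by_cases hxF : x ∈ F i
    · simp only [hB, hxF, and_self, if_true]
      rw [← ncard_sdiff_insert_add_one hx hxF, pow_succ]
      ring
    · simp only [hB, hxF, and_false, if_true, if_false, add_zero]
      rw [sdiff_insert_of_notMem hxF]
  · simp [hB]

theorem potential_insert_breaker :
    potential F M (insert y B) = potential F M B - danger F M B y := by
  rw [eq_sub_iff_add_eq, potential, potential, danger, ← sum_add_distrib]
  refine sum_congr rfl fun i _ => ?_
  by_cases hB : Disjoint (F i : Set X) B <;> by_cases hy : y ∈ F i <;>
    simp [hB, hy, Set.disjoint_insert_right]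

/-- Maker's claim of `x` changes the contributions of the winning sets through `x` only, and all
contributions lie between `0` and `1`. -/
theorem danger_insert_le [DecidableEq X] :
    danger F (insert x M) B y ≤ danger F M B y + #{i | x ∈ F i ∧ y ∈ F i} := by
  classical
  rw [danger, danger, ← sum_boole, ← sum_add_distrib]
  refine sum_le_sum fun i _ => ?_
  by_cases hB : Disjoint (F i : Set X) B ∧ y ∈ F i
  · by_cases hxF : x ∈ F i
    · simp only [hB, hxF, and_self, if_true]
      have h1 : (1 / 2 : ℝ) ^ ((F i : Set X) \ insert x M).ncard ≤ 1 :=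
        pow_le_one₀ (by norm_num) (by norm_num)
      have h2 : (0 : ℝ) ≤ (1 / 2 : ℝ) ^ ((F i : Set X) \ M).ncard := by positivity
      linarith
    · simp only [hB, hxF, and_self, false_and, if_true, if_false, add_zero]
      rw [sdiff_insert_of_notMem hxF]
  · simp only [hB, if_false, zero_add]
    split_ifs <;> norm_num

theorem exists_disjoint_of_potential_pos (h : 0 < potential F M B) :
    ∃ i, Disjoint (F i : Set X) B := by
  by_contra! hne
  simp [potential, hne] at h

end Potential

/-! ### Maker's win criterion -/

section Criterion

variable {X ι : Type*} [Fintype ι] {F : ι → Finset X}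

open Classical in
/-- Beck's strategy: claim an unclaimed element of the largest danger. -/
noncomputable def beckStrategy [Nonempty X] (F : ι → Finset X) (board : Finset X) (first : Player)
    (h : List X) : X :=
  if hne : ({x ∈ board | x ∉ h} : Finset X).Nonempty then
    (exists_max_image _ (danger F (claimedBy first h .maker) (claimedBy first h .breaker))
      hne).choose
  else Classical.arbitrary X

theorem beckStrategy_spec [Nonempty X] {board : Finset X} {first : Player} {h : List X}
    (hne : ∃ x ∈ board, x ∉ h) :
    (beckStrategy F board first h ∈ board ∧ beckStrategy F board first h ∉ h) ∧
      ∀ y ∈ board, y ∉ h →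
        danger F (claimedBy first h .maker) (claimedBy first h .breaker) y ≤
          danger F (claimedBy first h .maker) (claimedBy first h .breaker)
            (beckStrategy F board first h) := by
  classical
  have hne' : ({x ∈ board | x ∉ h} : Finset X).Nonempty := by
    obtain ⟨x, hx⟩ := hne
    exact ⟨x, by simpa using hx⟩
  have := (exists_max_image _
    (danger F (claimedBy first h .maker) (claimedBy first h .breaker)) hne').choose_spec
  rw [beckStrategy, dif_pos hne']
  simpa only [mem_filter, and_imp] using this

open Classical in
/-- The invariant of Beck's strategy, where `D` bounds the number of the winning sets through two
elements and `S` contains all winning sets: the potential exceeds `D` times the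
number of unclaimed elements of `S`, and on Breaker's turn it will still do so after any move of his. -/
theorem beckStrategy_invariant [Nonempty X] {board S : Finset X} {first : Player} {D C : ℝ}
    (hD0 : 0 ≤ D) (hFS : ∀ i, F i ⊆ S)
    (hD : ∀ x y, x ≠ y → (#{i | x ∈ F i ∧ y ∈ F i} : ℝ) ≤ D)
    (hC : ∀ x, (#{i | x ∈ F i} : ℝ) ≤ C)
    (hsum : D * #S + C < ∑ i, (1 / 2 : ℝ) ^ #(F i)) (h : List X) (hplay : IsPlay board h)
    (hfol : Follows first .maker (beckStrategy F board first) h) :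
    D * #{x ∈ S | x ∉ h} <
        potential F (claimedBy first h .maker) (claimedBy first h .breaker) ∧
      (mover first h.length = .breaker → ∀ y ∈ board, y ∉ h →
        D * #{x ∈ S | x ∉ h} <
          potential F (claimedBy first h .maker) (insert y (claimedBy first h .breaker))) := by
  induction h using List.reverseRecOn with
  | nil =>
    have hpot : potential F ∅ ∅ = ∑ i, (1 / 2 : ℝ) ^ #(F i) := by simp [potential]
    have key (y : X) : D * #S < potential F ∅ (insert y ∅) := by
      rw [potential_insert_breaker, hpot]
      linarith [hC y, danger_le_card (F := F) (M := ∅) (B := ∅) (x := y)]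
    have hC0 : 0 ≤ C := le_trans (by positivity) (hC (Classical.arbitrary X))
    simp only [claimedBy_nil, List.not_mem_nil, not_false_eq_true, filter_true]
    exact ⟨by rw [hpot]; linarith, fun _ y _ _ => key y⟩
  | append_singleton h x ih =>
    obtain ⟨hplay', hxb, hxh⟩ := hplay.of_concat
    obtain ⟨hfol', hmove⟩ := hfol.of_concat
    obtain ⟨ih1, ih2⟩ := ih hplay' hfol'
    set M := claimedBy first h .maker
    set B := claimedBy first h .breaker
    have hxM : x ∉ M := fun hx => hxh (mem_of_mem_claimedBy hx)
    have hmono : (#{z ∈ S | z ∉ h ++ [x]} : ℝ) ≤ #{z ∈ S | z ∉ h} := by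
      gcongr with z
      simp only [List.mem_append]
      tauto
    have hlen : (h ++ [x]).length = h.length + 1 := by simp
    rw [hlen, mover_succ]
    rcases hm : mover first h.length with _ | _
    · rw [claimedBy_concat_self hm, claimedBy_concat_of_ne (by rw [hm]; nofun)]
      have hxσ := hmove hm
      have hmax := (beckStrategy_spec (F := F) (first := first) ⟨x, hxb, hxh⟩).2
      rw [← hxσ] at hmax
      refine ⟨?_, fun _ y hyb hyh => ?_⟩
      · rw [potential_insert_maker hxM]
        have := danger_nonneg (F := F) (M := M) (B := B) (x := x)
        have := mul_le_mul_of_nonneg_left hmono hD0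
        linarith
      · rw [potential_insert_breaker, potential_insert_maker hxM]
        simp only [List.mem_append, List.mem_singleton, not_or] at hyh
        have h1 := hmax y hyb hyh.1
        have h2 := danger_insert_le (F := F) (M := M) (B := B) (x := x) (y := y)
        by_cases hxS : x ∈ S
        · have h3 := hD x y (Ne.symm hyh.2)
          have h4 : (#{z ∈ S | z ∉ h} : ℝ) = #{z ∈ S | z ∉ h ++ [x]} + 1 := by
            rw [← Nat.cast_add_one, Nat.cast_inj]
            rw [← card_erase_add_one (show x ∈ ({z ∈ S | z ∉ h} : Finset X) by simp [hxS, hxh])]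
            congr 2
            ext z
            simp only [mem_erase, mem_filter, List.mem_append, List.mem_singleton, not_or]
            tauto
          rw [h4] at ih1
          linarith
        · -- no winning set meets the claimed element, so the potential is unaffected
          have h3 : (#{i | x ∈ F i ∧ y ∈ F i} : ℝ) = 0 := by
            rw [Nat.cast_eq_zero, card_eq_zero, filter_eq_empty_iff]
            exact fun i _ hi => hxS (hFS i hi.1)
          have := mul_le_mul_of_nonneg_left hmono hD0
          linarith
    · rw [claimedBy_concat_self hm, claimedBy_concat_of_ne (by rw [hm]; nofun)]
      refine ⟨?_, by nofun⟩
      have := mul_le_mul_of_nonneg_left hmono hD0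
      linarith [ih2 hm x hxb hxh]

open Classical in
/-- A form of Beck's criterion for Maker's win, for either player moving first. -/
theorem makerWins_of_sum_gt [Nonempty X] {board S : Finset X} {winning : Set (Set X)} {D C : ℝ}
    (hD0 : 0 ≤ D) (hwin : ∀ i, (F i : Set X) ∈ winning) (hboard : ∀ i, F i ⊆ board)
    (hFS : ∀ i, F i ⊆ S)
    (hD : ∀ x y, x ≠ y → (#{i | x ∈ F i ∧ y ∈ F i} : ℝ) ≤ D)
    (hC : ∀ x, (#{i | x ∈ F i} : ℝ) ≤ C)
    (hsum : D * #S + C < ∑ i, (1 / 2 : ℝ) ^ #(F i)) (first : Player) :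
    MakerWins first board winning := by
  refine ⟨beckStrategy F board first, fun h hplay hfin _ => ?_, fun h hfin hfol => ?_⟩
  · refine (beckStrategy_spec ?_).1
    by_contra! hall
    exact hfin ⟨hplay, hall⟩
  · have hpot := (beckStrategy_invariant hD0 hFS hD hC hsum h hfin.1 hfol).1
    obtain ⟨i, hi⟩ := exists_disjoint_of_potential_pos (lt_of_le_of_lt (by positivity) hpot)
    refine ⟨F i, hwin i, fun x hx => ?_⟩
    exact (mem_claimedBy_maker_or_breaker (hfin.2 x (hboard i hx))).resolve_right
      (Set.disjoint_left.1 hi hx)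

end Criterion

/-! ### Copies of `H` in a blow-up of `H` -/

section BlowUp

variable {V W : Type*} [Fintype W] {s : ℕ}

open Classical in
/-- Prescribing the values of a map at `#P` points leaves `s ^ (#W - #P)` choices. The statement
avoids the subtraction. -/
theorem card_filter_subset_range_mul_le (v : W × Fin s ↪ V) (P : Finset V) :
    #{φ : W → Fin s | ∀ p ∈ P, ∃ w, v (w, φ w) = p} * s ^ #P ≤ s ^ Fintype.card W := by
  rcases Finset.eq_empty_or_nonempty
    ({φ : W → Fin s | ∀ p ∈ P, ∃ w, v (w, φ w) = p} : Finset (W → Fin s)) with he | ⟨φ₀, hφ₀⟩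
  · simp [he]
  simp only [mem_filter, mem_univ, true_and] at hφ₀
  let A : Finset W := {w | v (w, φ₀ w) ∈ P}
  have hA : #P ≤ #A := by
    refine (card_le_card (t := A.image fun w => v (w, φ₀ w)) fun p hp => ?_).trans card_image_le
    obtain ⟨w, rfl⟩ := hφ₀ p hp
    exact mem_image.2 ⟨w, by simpa [A] using hp, rfl⟩
  -- a map in the family is determined by its values outside `A`
  have hcard : #{φ : W → Fin s | ∀ p ∈ P, ∃ w, v (w, φ w) = p} ≤
      Fintype.card ({w // w ∉ A} → Fin s) := by
    refine card_le_card_of_injOn (t := univ) (fun φ w => φ w) (by simp) ?_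
    have hon : ∀ φ : W → Fin s, (∀ p ∈ P, ∃ w, v (w, φ w) = p) → ∀ w ∈ A, φ w = φ₀ w := by
      intro φ hφ w hw
      obtain ⟨u, hu⟩ := hφ _ (mem_filter.1 hw).2
      have := v.injective hu
      simp only [Prod.mk.injEq] at this
      obtain ⟨rfl, h⟩ := this
      exact h
    intro φ hφ ψ hψ h
    simp only [coe_filter, mem_univ, true_and, Set.mem_ofPred_eq] at hφ hψ
    funext w
    by_cases hw : w ∈ A
    · rw [hon φ hφ w hw, hon ψ hψ w hw]
    · exact congrFun h ⟨w, hw⟩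
  rcases Nat.eq_zero_or_pos s with rfl | hs
  · by_cases hP : #P = 0
    · have hW : IsEmpty W := ⟨fun w => (φ₀ w).elim0⟩
      simpa [hP, Fintype.card_eq_zero] using hcard
    · simp [hP]
  · calc _ ≤ Fintype.card ({w // w ∉ A} → Fin s) * s ^ #A :=
          Nat.mul_le_mul hcard (Nat.pow_le_pow_right hs hA)
      _ = s ^ Fintype.card W := by
          rw [Fintype.card_fun, Fintype.card_fin, ← pow_add]
          congr 1
          rw [Fintype.card_subtype_compl, Fintype.card_coe]
          exact Nat.sub_add_cancel (card_le_univ A)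

open Classical in
/-- The edge set of the copy of `H` that a choice of one vertex `v (w, φ w)` from each class of a
blow-up of `H` spans. -/
noncomputable def transversalEdges (H : SimpleGraph W) (v : W × Fin s ↪ V) (φ : W → Fin s) :
    Finset (Sym2 V) :=
  H.edgeFinset.image (Sym2.map fun w => v (w, φ w))

variable {H : SimpleGraph W} {v : W × Fin s ↪ V} {φ : W → Fin s} {e e' : Sym2 V}

theorem mem_transversalEdges :
    e ∈ transversalEdges H v φ ↔ ∃ d ∈ H.edgeSet, Sym2.map (fun w => v (w, φ w)) d = e := by
  simp [transversalEdges]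

theorem card_transversalEdges_le : #(transversalEdges H v φ) ≤ H.edgeSet.ncard := by
  classical
  refine card_image_le.trans_eq ?_
  rw [← Set.ncard_coe_finset, SimpleGraph.coe_edgeFinset]

theorem exists_eq_of_mem_transversalEdges (he : e ∈ transversalEdges H v φ) {p : V} (hp : p ∈ e) :
    ∃ w, v (w, φ w) = p := by
  obtain ⟨d, -, rfl⟩ := mem_transversalEdges.1 he
  obtain ⟨w, -, hw⟩ := Sym2.mem_map.1 hp
  exact ⟨w, hw⟩

theorem not_isDiag_of_mem_transversalEdges (he : e ∈ transversalEdges H v φ) : ¬ e.IsDiag := by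
  obtain ⟨d, hd, rfl⟩ := mem_transversalEdges.1 he
  rw [Sym2.isDiag_map fun a b h => congrArg Prod.fst (v.injective h)]
  exact H.not_isDiag_of_mem_edgeSet hd

theorem three_le_card_union_toFinset [DecidableEq V] (he : ¬ e.IsDiag) (he' : ¬ e'.IsDiag)
    (hne : e ≠ e') : 3 ≤ #(e.toFinset ∪ e'.toFinset) := by
  by_contra! hlt
  have h1 := Sym2.card_toFinset_of_not_isDiag e he
  have h2 := Sym2.card_toFinset_of_not_isDiag e' he'
  have h3 := eq_of_subset_of_card_le (subset_union_left (s₁ := e.toFinset) (s₂ := e'.toFinset))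
    (by omega)
  have h4 := eq_of_subset_of_card_le (subset_union_right (s₁ := e.toFinset) (s₂ := e'.toFinset))
    (by omega)
  refine hne (Sym2.ext fun x => ?_)
  rw [← Sym2.mem_toFinset, ← Sym2.mem_toFinset, h3.trans h4.symm]

open Classical in
theorem card_filter_mem_transversalEdges_le (hs : 0 < s) (e : Sym2 V) :
    (#{φ | e ∈ transversalEdges H v φ} : ℝ) ≤ (s : ℝ) ^ Fintype.card W / s ^ 2 := by
  classical
  rw [le_div_iff₀ (by positivity)]
  norm_cast
  by_cases he : e.IsDiag
  · rw [filter_false_of_mem fun φ _ h => not_isDiag_of_mem_transversalEdges h he]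
    simp
  · rw [← Sym2.card_toFinset_of_not_isDiag e he]
    refine le_trans ?_ (card_filter_subset_range_mul_le v e.toFinset)
    gcongr with φ
    exact fun h p hp => exists_eq_of_mem_transversalEdges h (Sym2.mem_toFinset.1 hp)

open Classical in
/-- Two edges span at least three vertices, which accounts for the exponent. -/
theorem card_filter_mem_mem_transversalEdges_le (hs : 0 < s) (hne : e ≠ e') :
    (#{φ | e ∈ transversalEdges H v φ ∧ e' ∈ transversalEdges H v φ} : ℝ) ≤
      (s : ℝ) ^ Fintype.card W / s ^ 3 := by
  classical
  rw [le_div_iff₀ (by positivity)]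
  norm_cast
  by_cases he : e.IsDiag
  · rw [filter_false_of_mem fun φ _ h => not_isDiag_of_mem_transversalEdges h.1 he]
    simp
  by_cases he' : e'.IsDiag
  · rw [filter_false_of_mem fun φ _ h => not_isDiag_of_mem_transversalEdges h.2 he']
    simp
  refine le_trans ?_ (card_filter_subset_range_mul_le v (e.toFinset ∪ e'.toFinset))
  refine Nat.mul_le_mul (card_le_card <| monotone_filter_right _ fun φ _ => ?_)
    (Nat.pow_le_pow_right hs ?_)
  · rintro ⟨h, h'⟩ p hp
    rcases mem_union.1 hp with hp | hp
    · exact exists_eq_of_mem_transversalEdges h (Sym2.mem_toFinset.1 hp)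
    · exact exists_eq_of_mem_transversalEdges h' (Sym2.mem_toFinset.1 hp)
  · exact three_le_card_union_toFinset he he' hne

/-- Maker wins the `H`-game on every graph that contains a large enough blow-up of `H`. -/
theorem makerWins_copyEdgeSets_of_blowUp [Nonempty W] [Fintype V] [DecidableEq V]
    (G : SimpleGraph V) [DecidableRel G.Adj] (v : W × Fin s ↪ V)
    (hv : ∀ a b, H.Adj a.1 b.1 → G.Adj (v a) (v b))
    (hs : (Fintype.card W ^ 2 + 1) * 2 ^ H.edgeSet.ncard < s) (first : Player) :
    MakerWins first G.edgeFinset (copyEdgeSets H G) := by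
  classical
  have hs0 : 0 < s := by omega
  set m := Fintype.card W with hm
  have : Nonempty V := ⟨v (Classical.arbitrary W, ⟨0, hs0⟩)⟩
  have : Nonempty (Sym2 V) := ⟨s(Classical.arbitrary V, Classical.arbitrary V)⟩
  refine makerWins_of_sum_gt (F := transversalEdges H v) (D := (s : ℝ) ^ m / s ^ 3)
    (C := (s : ℝ) ^ m / s ^ 2)
    (S := (univ : Finset ((W × Fin s) × (W × Fin s))).image fun q => s(v q.1, v q.2))
    (by positivity) (fun φ => ?_) (fun φ e he => ?_) (fun φ e he => ?_)
    (fun e e' hne => ?_) (fun e => ?_) ?_ first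
  · exact ⟨⟨⟨fun w => v (w, φ w), fun h => hv _ _ h⟩,
      fun a b h => congrArg Prod.fst (v.injective h)⟩, by
        simp [transversalEdges]; rfl⟩
  · obtain ⟨d, hd, rfl⟩ := mem_transversalEdges.1 he
    induction d with
    | h a b => simpa using hv (a, φ a) (b, φ b) (by simpa using hd)
  · obtain ⟨d, hd, rfl⟩ := mem_transversalEdges.1 he
    induction d with
    | h a b => exact mem_image.2 ⟨((a, φ a), (b, φ b)), mem_univ _, rfl⟩
  · convert card_filter_mem_mem_transversalEdges_le (H := H) (v := v) hs0 hne
  · convert card_filter_mem_transversalEdges_le (H := H) (v := v) hs0 e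
  · have hS : (#((univ : Finset ((W × Fin s) × (W × Fin s))).image fun q => s(v q.1, v q.2)) : ℝ) ≤
        (m * s) ^ 2 := by
      norm_cast
      refine card_image_le.trans ?_
      simp [hm, sq]
    set k := H.edgeSet.ncard
    have hF (φ : W → Fin s) : (1 / 2 : ℝ) ^ k ≤ (1 / 2 : ℝ) ^ #(transversalEdges H v φ) := by
      refine pow_le_pow_of_le_one (by norm_num) (by norm_num) card_transversalEdges_le
    have hsR : ((m : ℝ) ^ 2 + 1) * 2 ^ k < s := by exact_mod_cast hs
    have hs1 : (1 : ℝ) ≤ s := by exact_mod_cast hs0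
    calc _ ≤ (s : ℝ) ^ m / s ^ 3 * (m * s) ^ 2 + (s : ℝ) ^ m / s ^ 2 := by gcongr
      _ = (s : ℝ) ^ m * (m ^ 2 / s + 1 / s ^ 2) := by field_simp
      _ ≤ (s : ℝ) ^ m * (m ^ 2 / s + 1 / s) := by
          gcongr
          exact le_self_pow₀ hs1 two_ne_zero
      _ < (s : ℝ) ^ m * (1 / 2) ^ k := by
          gcongr
          rw [← add_div, one_div_pow, div_lt_div_iff₀ (by positivity) (by positivity), one_mul]
          exact hsR
      _ = ∑ φ : W → Fin s, (1 / 2 : ℝ) ^ k := by simp [hm]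
      _ ≤ _ := sum_le_sum fun φ _ => hF φ

end BlowUp

/-! ### Finding a blow-up in a dense graph -/

open SimpleGraph in
/-- The vertices of a colour class of `H` blow up inside one part of `K_r(t)`. -/
theorem exists_blowUp_of_isContained {V W : Type*} [Fintype W] {H : SimpleGraph W}
    {G : SimpleGraph V} {r s : ℕ} (c : H.Coloring (Fin r))
    (hG : completeEquipartiteGraph r (Fintype.card (W × Fin s)) ⊑ G) :
    ∃ v : W × Fin s ↪ V, ∀ a b, H.Adj a.1 b.1 → G.Adj (v a) (v b) := by
  obtain ⟨f⟩ := hG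
  refine ⟨⟨fun a => f (c a.1, Fintype.equivFin _ a), fun a b h => ?_⟩, fun a b h => ?_⟩
  · exact (Fintype.equivFin _).injective (congrArg Prod.snd (f.injective h))
  · exact f.toHom.map_adj (completeEquipartiteGraph_adj.2 (c.valid h))

open SimpleGraph in
/-- The minimum-degree Erdős–Stone theorem on an arbitrary vertex type. -/
theorem exists_forall_isContained_of_minDegree (r t : ℕ) (hr : 2 ≤ r) (α : ℝ)
    (hα : ((r : ℝ) - 2) / ((r : ℝ) - 1) < α) :
    ∃ n₀ : ℕ, ∀ n, n₀ ≤ n → ∀ (V : Type*) [Fintype V] (G : SimpleGraph V) [DecidableRel G.Adj],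
      Fintype.card V = n → α * (n : ℝ) ≤ (G.minDegree : ℝ) →
        completeEquipartiteGraph r t ⊑ G := by
  classical
  obtain ⟨q, rfl⟩ : ∃ q, r = q + 1 := ⟨r - 1, by omega⟩
  have hq : (q : ℝ) ≠ 0 := by norm_cast; omega
  have hα' : 1 - 1 / (q : ℝ) < α := by
    rwa [show ((q + 1 : ℕ) : ℝ) - 2 = q - 1 by push_cast; ring,
      show ((q + 1 : ℕ) : ℝ) - 1 = q by push_cast; ring, sub_div, div_self hq] at hα
  obtain ⟨n₀, hn₀⟩ := Filter.eventually_atTop.1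
    (eventually_completeEquipartiteGraph_isContained_of_minDegree (sub_pos.2 hα') q t)
  refine ⟨max n₀ 1, fun n hn V _ G _ hV hdeg => ?_⟩
  have hn1 : 0 < n := by omega
  have : Nonempty (Fin n) := ⟨⟨0, hn1⟩⟩
  have e := G.overFinIso hV
  refine (hn₀ n (by omega) (G := G.overFin hV) ?_).trans ⟨e.symm.toCopy⟩
  rw [add_sub_cancel]
  refine hdeg.trans ?_
  norm_cast
  refine le_minDegree_of_forall_le_degree _ _ fun x => ?_
  rw [← e.symm.degree_eq x]
  exact G.minDegree_le_degree _

end PositionalGame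

open PositionalGame in
theorem theorem1p1 {W : Type*} [Fintype W] (H : SimpleGraph W) (r : ℕ) (hr : 2 ≤ r)
    (hH : H.chromaticNumber = (r : ℕ∞)) (α : ℝ)
    (hα_lower : ((r : ℝ) - 2) / ((r : ℝ) - 1) < α) (hα_upper : α ≤ ((r : ℝ) - 1) / (r : ℝ)) :
    ∃ n₀ : ℕ, ∀ n : ℕ, n₀ ≤ n →
      ∀ (V : Type*) [Fintype V] [DecidableEq V] (G : SimpleGraph V) [DecidableRel G.Adj],
        Fintype.card V = n → α * (n : ℝ) ≤ (G.minDegree : ℝ) →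
          ∀ first : PositionalGame.Player,
            PositionalGame.MakerWins first G.edgeFinset (PositionalGame.copyEdgeSets H G) := by
  classical
  obtain ⟨c⟩ : H.Colorable r := SimpleGraph.chromaticNumber_le_iff_colorable.1 hH.le
  have : Nonempty W := by
    by_contra hW
    rw [not_nonempty_iff] at hW
    rw [SimpleGraph.chromaticNumber_eq_zero_of_isEmpty] at hH
    have : r = 0 := by exact_mod_cast hH.symm
    omega
  -- the class size of the blow-up depends on `H` only
  let s := (Fintype.card W ^ 2 + 1) * 2 ^ H.edgeSet.ncard + 1
  obtain ⟨n₀, hn₀⟩ :=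
    exists_forall_isContained_of_minDegree r (Fintype.card (W × Fin s)) hr α hα_lower
  refine ⟨n₀, fun n hn V _ _ G _ hV hdeg first => ?_⟩
  obtain ⟨v, hv⟩ := exists_blowUp_of_isContained c (hn₀ n hn V G hV hdeg)
  exact makerWins_copyEdgeSets_of_blowUp G v hv (Nat.lt_succ_self _) first
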